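/- For $l,m\in\mathbb{N}$, let $SK_{1,l}$ be the subdivided star obtained from $l$ copies of the path $P_3$ by identifying one pendant vertex of each copy to a single vertex, the coalescence vertex (for $l=0$ it is this vertex alone). Let $T_{l,m}$ be the graph obtained from the disjoint union of $SK_{1,l}$ and $SK_{1,m}$ by joining their coalescence vertices by an edge. For a finite simple graph $G$ with adjacency matrix $A$, let $U(t)=\exp(\mathrm{i}tA)$ for $t\in\mathbb{R}$, and let $\mathbf{e}_v$ denote the characteristic vector of a vertex $v$. **Theorem.** For every natural number $l$, there is pretty good state transfer in $T_{l,l}$ between its two coalescence vertices $a\ne b$ with respect to a sequence in $(4\mathbb{Z}-1)\frac{\pi}{2}$. That is, there are a sequence $(\tau_k)$ of real numbers, each of the form $(4q-1)\frac{\pi}{2}$ with $q\in\mathbb{Z}$, and a number $\gamma\in\mathbb{C}$ such that $$\lim_{k\to\infty}U(\tau_k)\,\mathbf{e}_a=\gamma\,\mathbf{e}_b .$$ -/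

import Mathlib

open Filter Topology

/-- The subdivided star with `l` branches: `l` copies of the path on three vertices, with one
pendant vertex of each copy identified to a single coalescence vertex `none`. In the branch `i`,
the vertex `some (i, 0)` is the middle vertex of the path and `some (i, 1)` is the remaining
pendant vertex. -/
def subdividedStar (l : ℕ) : SimpleGraph (Option (Fin l × Fin 2)) :=
  SimpleGraph.fromRel fun u v =>
    (u = none ∧ ∃ i, v = some (i, 0)) ∨ ∃ i, u = some (i, 0) ∧ v = some (i, 1)

/-- The vertices of the double subdivided star: those of the two subdivided stars. -/
abbrev DoubleStarVertex (l m : ℕ) : Type :=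
  Option (Fin l × Fin 2) ⊕ Option (Fin m × Fin 2)

/-- The coalescence vertex of the first subdivided star. -/
def coalescenceLeft (l m : ℕ) : DoubleStarVertex l m := Sum.inl none

/-- The coalescence vertex of the second subdivided star. -/
def coalescenceRight (l m : ℕ) : DoubleStarVertex l m := Sum.inr none

/-- The double subdivided star `T_{l,m}`: the disjoint union of two subdivided stars, with an
additional edge joining their coalescence vertices. -/
def doubleSubdividedStar (l m : ℕ) : SimpleGraph (DoubleStarVertex l m) :=
  (subdividedStar l).sum (subdividedStar m) ⊔
    SimpleGraph.edge (coalescenceLeft l m) (coalescenceRight l m)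

open Classical in
/-- The transition matrix `U(t) = exp(itA)`, where `A` is the adjacency matrix of `G`. -/
noncomputable def transitionMatrix {V : Type*} [Fintype V] [DecidableEq V]
    (G : SimpleGraph V) (t : ℝ) : Matrix V V ℂ :=
  NormedSpace.exp ((Complex.I * (t : ℂ)) • G.adjMatrix ℂ)

/-- Pretty good state transfer in `G` between the distinct vertices `a` and `b`, with respect to
a sequence of times in `S`. -/
def PrettyGoodStateTransferIn {V : Type*} [Fintype V] [DecidableEq V]
    (G : SimpleGraph V) (a b : V) (S : Set ℝ) : Prop :=
  a ≠ b ∧ ∃ (τ : ℕ → ℝ) (γ : ℂ), (∀ k, τ k ∈ S) ∧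
    Tendsto (fun k => (transitionMatrix G (τ k)).mulVec (Pi.single a 1)) atTop
      (𝓝 (γ • Pi.single b (1 : ℂ)))

/-! For `s = ±1`, `e_a + s e_b` is a combination of eigenvectors with eigenvalues `s x`, where `x`
runs over the roots of `X³ - X² - (l+1)X + 1`. If `exp(iτx) → i` for all three roots, the walk
multiplies `e_a + e_b` by `i` and `e_a - e_b` by `-i` in the limit, so `e_a` goes to `i e_b`
(`tendsto_transitionMatrix_mulVec`).

At `τ ∈ (4ℤ-1)π/2` we have `exp(iτ) = -i = i³`. The roots sum to 1, so control of two phases gives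
the third. For two roots `x ≠ y`, Kronecker's theorem suffices, since `1, x, y` are independent over
`ℤ` (`int_relation_cubic_roots`). The case `l = 0` is `K₂`, where transfer is exact. -/

/-! ### Kronecker's theorem by averaging -/

/-- The Cesàro means of the powers of a unimodular number tend to `1` or to `0`. -/
theorem tendsto_inv_mul_sum_pow {ζ : ℂ} (hζ : ‖ζ‖ = 1) :
    Tendsto (fun N : ℕ => (N : ℂ)⁻¹ * ∑ q ∈ Finset.range N, ζ ^ q) atTop
      (𝓝 (if ζ = 1 then 1 else 0)) := by
  split_ifs with h
  · subst h
    refine tendsto_const_nhds.congr' ?_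
    filter_upwards [eventually_ne_atTop 0] with N hN
    simp [hN]
  · have hb : ∀ N : ℕ, ‖∑ q ∈ Finset.range N, ζ ^ q‖ ≤ 2 / ‖ζ - 1‖ := fun N => by
      rw [geom_sum_eq h, norm_div]
      gcongr
      refine (norm_sub_le _ _).trans ?_
      simp [hζ]
      norm_num
    refine squeeze_zero_norm (a := fun N : ℕ => (N : ℝ)⁻¹ * (2 / ‖ζ - 1‖)) (fun N => ?_) ?_
    · rw [norm_mul, norm_inv, Complex.norm_natCast]
      gcongr
      exact hb N
    · simpa using (tendsto_inv_atTop_nhds_zero_nat (𝕜 := ℝ)).mul_const (2 / ‖ζ - 1‖)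

/-- On the unit circle `conj u = u⁻¹`, so `|1 + u|² = (1 + u)² u⁻¹`. The constant term `j = k` is
the central binomial coefficient. -/
theorem norm_one_add_sq_pow_eq_sum {u : ℂ} (hu : ‖u‖ = 1) (k : ℕ) :
    (((‖1 + u‖ ^ 2) ^ k : ℝ) : ℂ) =
      ∑ j ∈ Finset.range (2 * k + 1), ((2 * k).choose j : ℂ) * u ^ ((j : ℤ) - k) := by
  have hu0 : u ≠ 0 := by
    rintro rfl
    simp at hu
  have h : ((‖1 + u‖ ^ 2 : ℝ) : ℂ) = (u + 1) ^ 2 * u⁻¹ := by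
    push_cast
    rw [← Complex.mul_conj', map_add, map_one, ← Complex.inv_eq_conj hu]
    field_simp
    ring
  rw [Complex.ofReal_pow, h, mul_pow, ← pow_mul, add_pow, Finset.sum_mul]
  refine Finset.sum_congr rfl fun j _ => ?_
  rw [zpow_sub₀ hu0, zpow_natCast, zpow_natCast, one_pow, inv_pow]
  ring

theorem norm_one_add_sq_add {u : ℂ} (hu : ‖u‖ = 1) : ‖1 + u‖ ^ 2 + ‖1 - u‖ ^ 2 = 4 := by
  have := parallelogram_law_with_norm ℝ (1 : ℂ) u
  simp only [hu, norm_one] at this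
  nlinarith

/-- The mean of a product of Fejér-type kernels along the powers of multiplicatively independent
unimodular numbers. -/
theorem tendsto_inv_mul_sum_prod_kernel {ι : Type*} [Fintype ι] [DecidableEq ι] {z w : ι → ℂ}
    (hz : ∀ i, ‖z i‖ = 1) (hw : ∀ i, ‖w i‖ = 1)
    (hind : ∀ n : ι → ℤ, ∏ i, z i ^ n i = 1 → n = 0) (k : ℕ) :
    Tendsto (fun N : ℕ => (N : ℝ)⁻¹ *
        ∑ q ∈ Finset.range N, ∏ i, (‖1 + z i ^ q * (w i)⁻¹‖ ^ 2) ^ k) atTop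
      (𝓝 ((k.centralBinom : ℝ) ^ Fintype.card ι)) := by
  set s : Finset (ι → ℕ) := Fintype.piFinset fun _ => Finset.range (2 * k + 1)
  set c : (ι → ℕ) → ℂ := fun f =>
    ∏ i, ((2 * k).choose (f i) : ℂ) * ((w i)⁻¹) ^ ((f i : ℤ) - k)
  set ζ : (ι → ℕ) → ℂ := fun f => ∏ i, z i ^ ((f i : ℤ) - k)
  have hF : ∀ q : ℕ, ((∏ i, (‖1 + z i ^ q * (w i)⁻¹‖ ^ 2) ^ k : ℝ) : ℂ) =
      ∑ f ∈ s, c f * ζ f ^ q := fun q => by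
    rw [Complex.ofReal_prod]
    have : ∀ i, (((‖1 + z i ^ q * (w i)⁻¹‖ ^ 2) ^ k : ℝ) : ℂ) = _ := fun i =>
      norm_one_add_sq_pow_eq_sum (u := z i ^ q * (w i)⁻¹) (by simp [hz, hw]) k
    simp_rw [this]
    rw [Finset.prod_univ_sum]
    refine Finset.sum_congr rfl fun f _ => ?_
    rw [← Finset.prod_pow, ← Finset.prod_mul_distrib]
    refine Finset.prod_congr rfl fun i _ => ?_
    rw [mul_zpow, ← zpow_natCast (z i) q, ← zpow_natCast (z i ^ _) q, ← zpow_mul, ← zpow_mul,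
      mul_comm (q : ℤ)]
    ring
  have hζ : ∀ f, ‖ζ f‖ = 1 := fun f => by
    simp [ζ, norm_prod, hz]
  -- Independence leaves only the constant Fourier mode in the mean.
  have hζ1 : ∀ f, ζ f = 1 ↔ f = fun _ => k := fun f => by
    refine ⟨fun h => funext fun i => ?_, ?_⟩
    · have := congrFun (hind _ h) i
      simp only [Pi.zero_apply] at this
      omega
    · rintro rfl
      simp [ζ]
  have hlim : Tendsto (fun N : ℕ => ∑ f ∈ s, c f * ((N : ℂ)⁻¹ * ∑ q ∈ Finset.range N, ζ f ^ q))
      atTop (𝓝 (∑ f ∈ s, c f * if ζ f = 1 then 1 else 0)) :=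
    tendsto_finsetSum _ fun f _ => (tendsto_inv_mul_sum_pow (hζ f)).const_mul _
  have hval : (∑ f ∈ s, c f * if ζ f = 1 then 1 else 0) =
      (((k.centralBinom : ℝ) ^ Fintype.card ι : ℝ) : ℂ) := by
    simp only [hζ1, mul_ite, mul_one, mul_zero]
    rw [Finset.sum_ite_eq', if_pos]
    · simp [c, Nat.centralBinom]
    · simp [s, Fintype.mem_piFinset]
      omega
  rw [hval] at hlim
  have := (Complex.continuous_re.tendsto _).comp hlim
  rw [Complex.ofReal_re] at this
  refine this.congr fun N => ?_
  have h2 : (∑ f ∈ s, c f * ((N : ℂ)⁻¹ * ∑ q ∈ Finset.range N, ζ f ^ q)) =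
      (((N : ℝ)⁻¹ * ∑ q ∈ Finset.range N, ∏ i, (‖1 + z i ^ q * (w i)⁻¹‖ ^ 2) ^ k : ℝ) : ℂ) := by
    rw [Complex.ofReal_mul, Complex.ofReal_sum]
    simp_rw [hF]
    rw [Finset.sum_comm, Finset.mul_sum]
    refine Finset.sum_congr rfl fun f _ => ?_
    simp_rw [Finset.mul_sum]
    push_cast
    refine Finset.sum_congr rfl fun q _ => ?_
    ring
  simp only [Function.comp_apply, h2, Complex.ofReal_re]

/-- **Kronecker's approximation theorem**: the powers of a tuple of multiplicatively independent
unimodular numbers are dense in the torus. -/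
theorem exists_forall_norm_pow_sub_lt {ι : Type*} [Fintype ι] {z w : ι → ℂ}
    (hz : ∀ i, ‖z i‖ = 1) (hw : ∀ i, ‖w i‖ = 1)
    (hind : ∀ n : ι → ℤ, ∏ i, z i ^ n i = 1 → n = 0) {ε : ℝ} (hε : 0 < ε) :
    ∃ q : ℕ, ∀ i, ‖z i ^ q - w i‖ < ε := by
  classical
  by_contra! hcon
  set n := Fintype.card ι
  set ρ : ℝ := 1 - ε ^ 2 / 4 with hρ
  have hu : ∀ q i, ‖z i ^ q * (w i)⁻¹‖ = 1 := fun q i => by simp [hz, hw]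
  have hle : ∀ q i, ‖1 + z i ^ q * (w i)⁻¹‖ ^ 2 ≤ 4 := fun q i => by
    have := norm_one_add_sq_add (hu q i)
    nlinarith [sq_nonneg ‖1 - z i ^ q * (w i)⁻¹‖]
  have hfar : ∀ q, ∃ i, ‖1 + z i ^ q * (w i)⁻¹‖ ^ 2 ≤ 4 * ρ := fun q => by
    obtain ⟨i, hi⟩ := hcon q
    refine ⟨i, ?_⟩
    have hw0 : w i ≠ 0 := fun h => by simpa [h] using hw i
    have h1 : ‖1 - z i ^ q * (w i)⁻¹‖ = ‖z i ^ q - w i‖ := by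
      have : 1 - z i ^ q * (w i)⁻¹ = -(z i ^ q - w i) * (w i)⁻¹ := by
        field_simp
        ring
      rw [this, norm_mul, norm_neg, norm_inv, hw, inv_one, mul_one]
    have h2 := norm_one_add_sq_add (hu q i)
    rw [h1] at h2
    nlinarith [pow_le_pow_left₀ hε.le hi 2]
  have hρ0 : 0 ≤ ρ := by
    obtain ⟨i, hi⟩ := hfar 0
    nlinarith [sq_nonneg ‖1 + z i ^ 0 * (w i)⁻¹‖]
  have hρ1 : ρ < 1 := by
    have := pow_pos hε 2
    linarith
  have hprod : ∀ q, ∏ i, ‖1 + z i ^ q * (w i)⁻¹‖ ^ 2 ≤ 4 ^ n * ρ := fun q => by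
    obtain ⟨i, hi⟩ := hfar q
    have hn : n = (Finset.univ.erase i).card + 1 := by
      rw [Finset.card_erase_add_one (Finset.mem_univ i), Finset.card_univ]
    rw [← Finset.mul_prod_erase _ _ (Finset.mem_univ i), hn, pow_succ]
    calc _ ≤ (4 * ρ) * 4 ^ (Finset.univ.erase i).card := by
          refine mul_le_mul hi ?_ (Finset.prod_nonneg fun j _ => by positivity) (by positivity)
          rw [← Finset.prod_const]
          exact Finset.prod_le_prod (fun j _ => by positivity) fun j _ => hle q j
      _ = _ := by ring
  have hbound : ∀ k : ℕ, (k.centralBinom : ℝ) ^ n ≤ (4 ^ n * ρ) ^ k := fun k => by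
    refine le_of_tendsto (tendsto_inv_mul_sum_prod_kernel hz hw hind k) ?_
    filter_upwards [eventually_gt_atTop 0] with N hN
    rw [inv_mul_le_iff₀ (by exact_mod_cast hN)]
    calc _ ≤ ∑ q ∈ Finset.range N, (4 ^ n * ρ) ^ k := Finset.sum_le_sum fun q _ => by
          rw [Finset.prod_pow]
          exact pow_le_pow_left₀ (Finset.prod_nonneg fun i _ => by positivity) (hprod q) k
      _ = _ := by simp
  -- Since `4^k ≤ 2k · centralBinom k`, the true mean is within a polynomial factor of `4^(nk)`,
  -- while the missed target costs the exponential factor `ρ^k`.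
  have hbound2 : ∀ k : ℕ, 0 < k → (1 : ℝ) ≤ 2 ^ n * ((k : ℝ) ^ n * ρ ^ k) := fun k hk => by
    have h4 : (4 : ℝ) ^ k ≤ 2 * k * k.centralBinom := by
      exact_mod_cast Nat.four_pow_le_two_mul_self_mul_centralBinom k hk
    have h5 := pow_le_pow_left₀ (by positivity) h4 n
    rw [mul_pow] at h5
    have h6 : ((4 : ℝ) ^ k) ^ n ≤ (2 * k) ^ n * (4 ^ n * ρ) ^ k :=
      h5.trans (by gcongr; exact hbound k)
    rw [mul_pow (4 ^ n), ← pow_mul, ← pow_mul, mul_comm n k] at h6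
    have h7 : (0 : ℝ) < 4 ^ (k * n) := by positivity
    rw [mul_pow] at h6
    refine le_of_mul_le_mul_left ?_ h7
    linarith
  have hlim := (tendsto_pow_const_mul_const_pow_of_abs_lt_one n
    (r := ρ) (by rwa [abs_of_nonneg hρ0])).const_mul (2 ^ n)
  rw [mul_zero] at hlim
  have : (1 : ℝ) ≤ 0 := ge_of_tendsto hlim <| by
    filter_upwards [eventually_gt_atTop 0] with k hk using hbound2 k hk
  norm_num at this

/-! ### Arithmetic of the cubic -/

section Cubic

open Polynomial

/-- A root of `X ^ 3 - X ^ 2 - (l + 1) X + 1`, `l > 0`, is not a root of a nonzero rational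
polynomial of degree at most two. -/
theorem coeff_eq_zero_of_cubic_root {l : ℕ} (hl : 0 < l) {x : ℝ}
    (hx : x ^ 3 - x ^ 2 - (l + 1) * x + 1 = 0) {c₀ c₁ c₂ : ℚ}
    (h : (c₀ : ℝ) + c₁ * x + c₂ * x ^ 2 = 0) : c₀ = 0 ∧ c₁ = 0 ∧ c₂ = 0 := by
  -- A rational root would be `±1`, where the cubic takes the values `∓l`.
  have hnoroot : ∀ r : ℚ, r ^ 3 - r ^ 2 - (l + 1) * r + 1 ≠ 0 := fun r hr => by
    have hmonic : (X ^ 3 - X ^ 2 - C ((l : ℤ) + 1) * X + 1 : ℤ[X]).Monic := by monicity!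
    obtain ⟨n, hn⟩ := isInteger_of_is_root_of_monic (K := ℚ) (r := r) hmonic (by simpa using hr)
    simp only [algebraMap_int_eq, eq_intCast] at hn
    rw [← hn] at hr
    have hn' : n ^ 3 - n ^ 2 - (l + 1) * n + 1 = 0 := by exact_mod_cast hr
    have hunit : IsUnit n := IsUnit.of_mul_eq_one (-(n ^ 2 - n - (l + 1))) (by linarith)
    rcases Int.isUnit_iff.1 hunit with rfl | rfl <;> norm_num at hn' <;> omega
  set P : ℚ[X] := X ^ 3 - X ^ 2 - C ((l : ℚ) + 1) * X + 1 with hP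
  have hdeg : P.natDegree = 3 := by
    rw [hP]
    compute_degree!
  have hirr : Irreducible P := irreducible_of_degree_le_three_of_not_isRoot (by simp [hdeg])
    fun r => by simpa [hP, IsRoot] using hnoroot r
  have hmonic : P.Monic := by
    rw [hP]
    monicity!
  have hmin : P = minpoly ℚ x :=
    minpoly.eq_of_irreducible_of_monic hirr (by simpa [hP] using hx) hmonic
  set Q : ℚ[X] := C c₀ + C c₁ * X + C c₂ * X ^ 2 with hQ
  have hdvd : P ∣ Q := hmin ▸ minpoly.dvd ℚ x (by simpa [hQ] using h)
  have hQ0 : Q = 0 := by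
    refine eq_zero_of_dvd_of_natDegree_lt hdvd ?_
    rw [hdeg]
    refine Nat.lt_succ_of_le ?_
    rw [hQ]
    compute_degree!
  have h0 := congrArg (fun p => coeff p 0) hQ0
  have h1 := congrArg (fun p => coeff p 1) hQ0
  have h2 := congrArg (fun p => coeff p 2) hQ0
  refine ⟨?_, ?_, ?_⟩
  · simpa [hQ, coeff_X, coeff_C] using h0
  · simpa [hQ, coeff_X, coeff_C, coeff_X_pow] using h1
  · simpa [hQ, coeff_X, coeff_C, coeff_X_pow] using h2

/-- Two distinct roots of `X ^ 3 - X ^ 2 - (l + 1) X + 1`, `l > 0`, and `1` are linearly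
independent over the integers. -/
theorem int_relation_cubic_roots {l : ℕ} (hl : 0 < l) {x y : ℝ} (hxy : x ≠ y)
    (hx : x ^ 3 - x ^ 2 - (l + 1) * x + 1 = 0) (hy : y ^ 3 - y ^ 2 - (l + 1) * y + 1 = 0)
    {m n k : ℤ} (h : m * x + n * y = (k : ℝ)) : m = 0 ∧ n = 0 := by
  by_cases hn : n = 0
  · subst hn
    have := coeff_eq_zero_of_cubic_root hl hx (c₀ := -k) (c₁ := m) (c₂ := 0)
      (by push_cast at h ⊢; linarith)
    exact ⟨by exact_mod_cast this.2.1, rfl⟩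
  exfalso
  obtain ⟨r, s, hrs⟩ : ∃ r s : ℚ, y = r + s * x := by
    refine ⟨k / n, -m / n, ?_⟩
    have : (n : ℝ) ≠ 0 := by exact_mod_cast hn
    push_cast
    field_simp
    linarith
  -- Coefficients of `P(r + sX) - s³P(X)`, with `P` the cubic: the degree drops to 2 and `x` is a
  -- root.
  obtain ⟨h0, h1, h2⟩ := coeff_eq_zero_of_cubic_root hl hx
    (c₀ := r ^ 3 - r ^ 2 - (l + 1) * r + 1 - s ^ 3)
    (c₁ := 3 * r ^ 2 * s - 2 * r * s - (l + 1) * s + (l + 1) * s ^ 3)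
    (c₂ := 3 * r * s ^ 2 - s ^ 2 + s ^ 3) (by
      rw [hrs] at hy
      push_cast
      linear_combination hy - (s : ℝ) ^ 3 * hx)
  have hs : s ≠ 0 := by
    rintro rfl
    have := (coeff_eq_zero_of_cubic_root hl hy (c₀ := -r) (c₁ := 1) (c₂ := 0)
      (by rw [hrs]; push_cast; ring)).2.1
    norm_num at this
  have hr : r = (1 - s) / 3 := by
    have : s ^ 2 * (3 * r - 1 + s) = 0 := by linear_combination h2
    have := (mul_eq_zero.1 this).resolve_left (pow_ne_zero 2 hs)
    linarith
  -- Evaluation of that polynomial at `1/3`, the mean of the roots, which `r + sX` fixes by `hr`.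
  -- Here `27 P(1/3) = 16 - 9l`, nonzero as 9 does not divide 16.
  have h3 : (16 - 9 * l : ℚ) * (1 - s ^ 3) = 0 := by
    subst hr
    linear_combination 27 * h0 + 9 * h1 + 3 * h2
  have hl16 : (16 - 9 * l : ℚ) ≠ 0 := by
    intro h
    have : (16 - 9 * l : ℤ) = 0 := by exact_mod_cast h
    omega
  have hs1 : s = 1 := by
    have h4 : (s - 1) * (s ^ 2 + s + 1) = 0 := by
      linear_combination -((mul_eq_zero.1 h3).resolve_left hl16)
    rcases mul_eq_zero.1 h4 with h | h
    · linarith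
    · nlinarith [sq_nonneg (2 * s + 1)]
  subst hs1
  norm_num at hr
  subst hr
  exact hxy (by simpa using hrs.symm)

/-- The signs at `-(l+2), 0, 1, l+2` alternate. -/
theorem exists_cubic_roots {l : ℕ} (hl : 0 < l) : ∃ x y z : ℝ, x < y ∧ y < z ∧
    x ^ 3 - x ^ 2 - (l + 1) * x + 1 = 0 ∧ y ^ 3 - y ^ 2 - (l + 1) * y + 1 = 0 ∧
    z ^ 3 - z ^ 2 - (l + 1) * z + 1 = 0 := by
  set p : ℝ → ℝ := fun x => x ^ 3 - x ^ 2 - (l + 1) * x + 1 with hp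
  have hc : Continuous p := by fun_prop
  have hl' : (0 : ℝ) < l := by exact_mod_cast hl
  obtain ⟨x, hx, hx0⟩ := intermediate_value_Ioo (a := -((l : ℝ) + 2)) (b := 0) (by linarith)
    hc.continuousOn (show (0 : ℝ) ∈ _ by
      constructor
      · simp only [hp]
        nlinarith [mul_pos hl' hl', mul_pos hl' (mul_pos hl' hl')]
      · simp [hp])
  obtain ⟨y, hy, hy0⟩ := intermediate_value_Ioo' (a := (0 : ℝ)) (b := 1) (by norm_num)
    hc.continuousOn (show (0 : ℝ) ∈ _ by
      constructor
      · simp only [hp]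
        linarith
      · simp [hp])
  obtain ⟨z, hz, hz0⟩ := intermediate_value_Ioo (a := (1 : ℝ)) (b := (l : ℝ) + 2) (by linarith)
    hc.continuousOn (show (0 : ℝ) ∈ _ by
      constructor
      · simp only [hp]
        linarith
      · simp only [hp]
        nlinarith [mul_pos hl' hl', mul_pos hl' (mul_pos hl' hl')])
  exact ⟨x, y, z, hx.2.trans hy.1, hy.2.trans hz.1, hx0, hy0, hz0⟩

theorem cubic_roots_sum {c x y z : ℝ} (hxy : x < y) (hyz : y < z)
    (hx : x ^ 3 - x ^ 2 - c * x + 1 = 0) (hy : y ^ 3 - y ^ 2 - c * y + 1 = 0)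
    (hz : z ^ 3 - z ^ 2 - c * z + 1 = 0) : x + y + z = 1 := by
  have h1 : (y - x) * (y ^ 2 + x * y + x ^ 2 - (x + y) - c) = 0 := by linear_combination hy - hx
  have h2 : (z - x) * (z ^ 2 + x * z + x ^ 2 - (x + z) - c) = 0 := by linear_combination hz - hx
  have h1' := (mul_eq_zero.1 h1).resolve_left (by linarith)
  have h2' := (mul_eq_zero.1 h2).resolve_left (by linarith)
  have h3 : (z - y) * (x + y + z - 1) = 0 := by linear_combination h2' - h1'
  have := (mul_eq_zero.1 h3).resolve_left (by linarith)
  linarith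

end Cubic

/-! ### Simultaneous approximation of two phases -/

/-- Real numbers whose phases `exp (i t x)` can all be brought close to `i` at times
`t ∈ (4ℤ - 1) π / 2`. -/
theorem exists_time_near_I {l : ℕ} (hl : 0 < l) {x y : ℝ} (hxy : x ≠ y)
    (hx : x ^ 3 - x ^ 2 - (l + 1) * x + 1 = 0) (hy : y ^ 3 - y ^ 2 - (l + 1) * y + 1 = 0)
    {ε : ℝ} (hε : 0 < ε) : ∃ q : ℤ,
      ‖Complex.exp (Complex.I * (((4 * (q : ℝ) - 1) * (Real.pi / 2) : ℝ) : ℂ) * x) - Complex.I‖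
        < ε ∧
      ‖Complex.exp (Complex.I * (((4 * (q : ℝ) - 1) * (Real.pi / 2) : ℝ) : ℂ) * y) - Complex.I‖
        < ε := by
  set v : Fin 2 → ℝ := ![x, y] with hv
  set E : ℝ → ℂ := fun θ => Complex.exp (θ * Complex.I) with hE
  have hEn : ∀ θ, ‖E θ‖ = 1 := fun θ => Complex.norm_exp_ofReal_mul_I θ
  -- As `(4q-1)π/2 = 2πq - π/2`, the fixed offset `-π/2` is moved into the target `w`.
  obtain ⟨q, hq⟩ := exists_forall_norm_pow_sub_lt (z := fun i => E (2 * Real.pi * v i))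
    (w := fun i => Complex.I * E (Real.pi / 2 * v i)) (fun i => hEn _) (fun i => by simp [hEn])
    (fun n h => by
      simp only [Fin.prod_univ_two, hE, ← Complex.exp_int_mul, ← Complex.exp_add] at h
      obtain ⟨k, hk⟩ := Complex.exp_eq_one_iff.1 h
      have h1 : (((n 0 * x + n 1 * y : ℝ) : ℂ) - ((k : ℝ) : ℂ)) * (2 * Real.pi * Complex.I) = 0 := by
        simp only [hv, Matrix.cons_val_zero, Matrix.cons_val_one] at hk
        push_cast at hk ⊢
        linear_combination hk
      have h2 := (mul_eq_zero.1 h1).resolve_right Complex.two_pi_I_ne_zero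
      have h3 : (n 0 * x + n 1 * y : ℝ) = (k : ℝ) := by
        rw [sub_eq_zero] at h2
        exact_mod_cast h2
      obtain ⟨h4, h5⟩ := int_relation_cubic_roots hl hxy hx hy h3
      funext i
      fin_cases i
      · exact h4
      · exact h5) hε
  have key : ∀ i, ‖Complex.exp (Complex.I * (((4 * ((q : ℤ) : ℝ) - 1) * (Real.pi / 2) : ℝ) : ℂ) *
      (v i : ℂ)) - Complex.I‖ < ε := fun i => by
    have h1 : Complex.exp (Complex.I * (((4 * ((q : ℤ) : ℝ) - 1) * (Real.pi / 2) : ℝ) : ℂ) *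
        (v i : ℂ)) - Complex.I = (E (2 * Real.pi * v i) ^ q - Complex.I * E (Real.pi / 2 * v i)) *
          E (-(Real.pi / 2 * v i)) := by
      have h2 : E (Real.pi / 2 * v i) * E (-(Real.pi / 2 * v i)) = 1 := by
        simp only [hE, ← Complex.exp_add]
        simp
      rw [sub_mul (E _ ^ q), mul_assoc Complex.I (E _), h2, mul_one]
      simp only [hE, ← Complex.exp_nat_mul, ← Complex.exp_add]
      congr 2
      push_cast
      ring
    rw [h1, norm_mul, hEn, mul_one]
    exact hq i
  exact ⟨q, key 0, key 1⟩

/-! ### Eigenvectors and the walk -/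

open scoped Matrix.Norms.Operator in
theorem exp_smul_mulVec_of_eigenvector {V : Type*} [Fintype V] [DecidableEq V]
    {A : Matrix V V ℂ} {v : V → ℂ} {μ : ℂ} (h : A.mulVec v = μ • v) (c : ℂ) :
    (NormedSpace.exp (c • A)).mulVec v = Complex.exp (c * μ) • v := by
  have hpow : ∀ n : ℕ, ((c • A) ^ n).mulVec v = (c * μ) ^ n • v := fun n => by
    induction n with
    | zero => simp
    | succ n ih =>
      rw [pow_succ, ← Matrix.mulVec_mulVec, Matrix.smul_mulVec, h, smul_smul, Matrix.mulVec_smul,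
        ih, smul_smul, pow_succ, mul_comm]
  have h1 := (NormedSpace.exp_series_hasSum_exp' (𝕂 := ℂ) (c • A)).map
    (Matrix.mulVec.addMonoidHomLeft v) (continuous_id.matrix_mulVec continuous_const)
  have h2 := (NormedSpace.exp_series_hasSum_exp' (𝕂 := ℂ) (c * μ)).smul_const v
  rw [← Complex.exp_eq_exp_ℂ] at h2
  refine h1.unique (h2.congr_fun ?_)
  intro n
  simp [Matrix.mulVec.addMonoidHomLeft, Matrix.smul_mulVec, hpow, smul_smul]

section Adjacency

variable {l m : ℕ}

theorem subdividedStar_adj_none_some {i : Fin l} {j : Fin 2} :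
    (subdividedStar l).Adj none (some (i, j)) ↔ j = 0 := by
  simp [subdividedStar, eq_comm]

theorem subdividedStar_adj_some_some {i i' : Fin l} {j j' : Fin 2} :
    (subdividedStar l).Adj (some (i, j)) (some (i', j')) ↔ i = i' ∧ j ≠ j' := by
  fin_cases j <;> fin_cases j' <;> simp [subdividedStar, eq_comm]

theorem doubleSubdividedStar_adj_inl_inl {u v : Option (Fin l × Fin 2)} :
    (doubleSubdividedStar l m).Adj (Sum.inl u) (Sum.inl v) ↔ (subdividedStar l).Adj u v := by
  simp [doubleSubdividedStar, SimpleGraph.edge_adj, coalescenceLeft, coalescenceRight]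

theorem doubleSubdividedStar_adj_inr_inr {u v : Option (Fin m × Fin 2)} :
    (doubleSubdividedStar l m).Adj (Sum.inr u) (Sum.inr v) ↔ (subdividedStar m).Adj u v := by
  simp [doubleSubdividedStar, SimpleGraph.edge_adj, coalescenceLeft, coalescenceRight]

theorem doubleSubdividedStar_adj_inl_inr {u : Option (Fin l × Fin 2)}
    {v : Option (Fin m × Fin 2)} :
    (doubleSubdividedStar l m).Adj (Sum.inl u) (Sum.inr v) ↔ u = none ∧ v = none := by
  simp [doubleSubdividedStar, SimpleGraph.edge_adj, coalescenceLeft, coalescenceRight]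

end Adjacency

/-- The vector on a subdivided star whose values at the coalescence vertex, the middle vertices
and the outer pendant vertices are `μ ^ 2 - 1`, `μ` and `1`. -/
def starVector (l : ℕ) (μ : ℂ) : Option (Fin l × Fin 2) → ℂ
  | none => μ ^ 2 - 1
  | some (_, 0) => μ
  | some (_, 1) => 1

/-- The vector on the double subdivided star made of `starVector` and its multiple by `s`. -/
def doubleStarVector (l : ℕ) (s μ : ℂ) : DoubleStarVertex l l → ℂ :=
  Sum.elim (starVector l μ) (s • starVector l μ)

-- The values of `starVector` solve the equations at pendant and middle vertices for every `μ`; the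
-- one left, at a coalescence vertex, is `hμ`.
open Classical in
theorem adjMatrix_mulVec_doubleStarVector {l : ℕ} {s μ : ℂ} (hs : s * s = 1)
    (hμ : (μ - s) * (μ ^ 2 - 1) = l * μ) :
    ((doubleSubdividedStar l l).adjMatrix ℂ).mulVec (doubleStarVector l s μ) =
      μ • doubleStarVector l s μ := by
  have hsymm : ∀ u v, (doubleSubdividedStar l l).Adj (Sum.inr u) (Sum.inl v) ↔
      v = none ∧ u = none := fun u v => by
    rw [SimpleGraph.adj_comm, doubleSubdividedStar_adj_inl_inr]
  have hstar : ∀ p : Fin l × Fin 2, (subdividedStar l).Adj (some p) none ↔ p.2 = 0 := fun p => by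
    rw [SimpleGraph.adj_comm, subdividedStar_adj_none_some]
  funext u
  simp only [Matrix.mulVec, dotProduct, SimpleGraph.adjMatrix_apply, Fintype.sum_sum_type,
    Fintype.sum_option, Fintype.sum_prod_type, Fin.sum_univ_two, Pi.smul_apply, smul_eq_mul]
  rcases u with (_ | ⟨i, j⟩) | (_ | ⟨i, j⟩)
  · simp [doubleSubdividedStar_adj_inl_inl, doubleSubdividedStar_adj_inl_inr,
      subdividedStar_adj_none_some, doubleStarVector, starVector]
    linear_combination -hμ
  · fin_cases j <;>
    simp [doubleSubdividedStar_adj_inl_inl, doubleSubdividedStar_adj_inl_inr,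
      subdividedStar_adj_some_some, hstar, doubleStarVector, starVector]
    ring
  · simp [doubleSubdividedStar_adj_inr_inr, hsymm,
      subdividedStar_adj_none_some, doubleStarVector, starVector]
    linear_combination (-s) * hμ - (μ ^ 2 - 1) * hs
  · fin_cases j <;>
    simp [doubleSubdividedStar_adj_inr_inr, hsymm,
      subdividedStar_adj_some_some, hstar, doubleStarVector, starVector]
    · ring
    · ring

theorem transitionMatrix_mulVec_doubleStarVector {l : ℕ} {s μ : ℂ} (hs : s * s = 1)
    (hμ : (μ - s) * (μ ^ 2 - 1) = l * μ) (t : ℝ) :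
    (transitionMatrix (doubleSubdividedStar l l) t).mulVec (doubleStarVector l s μ) =
      Complex.exp (Complex.I * t * μ) • doubleStarVector l s μ :=
  exp_smul_mulVec_of_eigenvector (adjMatrix_mulVec_doubleStarVector hs hμ) _

/-- Since `s² = 1`, the entries on the first star are `x_j² - 1`, `s x_j` and `1`, so the three
moments of `w` determine the sum. -/
theorem sum_smul_doubleStarVector {l : ℕ} {ι : Type*} [Fintype ι] {s : ℂ} (hs : s * s = 1)
    {w x : ι → ℂ} (h0 : ∑ j, w j = 0) (h1 : ∑ j, w j * x j = 0) (h2 : ∑ j, w j * x j ^ 2 = 1) :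
    ∑ j, w j • doubleStarVector l s (s * x j) =
      Pi.single (coalescenceLeft l l) 1 + s • Pi.single (coalescenceRight l l) 1 := by
  have hc : ∑ j, w j * ((s * x j) ^ 2 - 1) = 1 := by
    have : ∀ j, w j * ((s * x j) ^ 2 - 1) = w j * x j ^ 2 - w j := fun j => by
      linear_combination w j * x j ^ 2 * hs
    simp_rw [this]
    rw [Finset.sum_sub_distrib, h2, h0, sub_zero]
  have hm : ∑ j, w j * (s * x j) = 0 := by
    simp_rw [mul_left_comm _ s]
    rw [← Finset.mul_sum, h1, mul_zero]
  funext u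
  simp only [Finset.sum_apply, Pi.smul_apply, Pi.add_apply, smul_eq_mul]
  rcases u with (_ | ⟨i, j⟩) | (_ | ⟨i, j⟩)
  · simpa [coalescenceLeft, coalescenceRight, doubleStarVector, starVector] using hc
  · fin_cases j
    · simpa [coalescenceLeft, coalescenceRight, doubleStarVector, starVector] using hm
    · simpa [coalescenceLeft, coalescenceRight, doubleStarVector, starVector] using h0
  · simp only [coalescenceLeft, coalescenceRight, doubleStarVector, starVector, Sum.elim_inr,
      Pi.smul_apply, smul_eq_mul, mul_left_comm _ s]
    rw [← Finset.mul_sum, hc]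
    simp
  · fin_cases j
    · simp only [coalescenceLeft, coalescenceRight, doubleStarVector, starVector, Sum.elim_inr,
        Pi.smul_apply, smul_eq_mul, mul_left_comm _ s]
      simp [← Finset.mul_sum, h1]
    · simp only [coalescenceLeft, coalescenceRight, doubleStarVector, starVector, Sum.elim_inr,
        Pi.smul_apply, smul_eq_mul, mul_left_comm _ s]
      simp [← Finset.mul_sum, h0]

/-- If the phases of an eigenvalue decomposition of the symmetric part of the walk converge to
`i`, there is pretty good state transfer between the coalescence vertices. -/
theorem tendsto_transitionMatrix_mulVec {l : ℕ} {ι : Type*} [Fintype ι] {w x : ι → ℂ}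
    (hx : ∀ j, (x j - 1) * (x j ^ 2 - 1) = l * x j)
    (h0 : ∑ j, w j = 0) (h1 : ∑ j, w j * x j = 0) (h2 : ∑ j, w j * x j ^ 2 = 1) {τ : ℕ → ℝ}
    (hτ : ∀ j, Tendsto (fun k => Complex.exp (Complex.I * τ k * x j)) atTop (𝓝 Complex.I)) :
    Tendsto (fun k => (transitionMatrix (doubleSubdividedStar l l) (τ k)).mulVec
      (Pi.single (coalescenceLeft l l) 1)) atTop
      (𝓝 (Complex.I • Pi.single (coalescenceRight l l) (1 : ℂ))) := by
  have hpart : ∀ s : ℂ, s * s = 1 → ∀ γ : ℂ,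
      (∀ j, Tendsto (fun k => Complex.exp (Complex.I * τ k * (s * x j))) atTop (𝓝 γ)) →
      Tendsto (fun k => (transitionMatrix (doubleSubdividedStar l l) (τ k)).mulVec
        (Pi.single (coalescenceLeft l l) 1 + s • Pi.single (coalescenceRight l l) 1)) atTop
        (𝓝 (γ • (Pi.single (coalescenceLeft l l) 1 +
          s • Pi.single (coalescenceRight l l) 1))) := fun s hs γ hγ => by
    rw [← sum_smul_doubleStarVector hs h0 h1 h2, Finset.smul_sum]
    simp_rw [Matrix.mulVec_sum, Matrix.mulVec_smul]
    refine tendsto_finsetSum _ fun j _ => ?_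
    have hμ : (s * x j - s) * ((s * x j) ^ 2 - 1) = l * (s * x j) := by
      linear_combination s * hx j + (s * x j - s) * x j ^ 2 * hs
    simp_rw [transitionMatrix_mulVec_doubleStarVector hs hμ]
    rw [smul_comm γ (w j)]
    exact ((hγ j).smul_const _).const_smul _
  have hplus := hpart 1 (one_mul 1) Complex.I (by simpa using hτ)
  -- Negating the eigenvalues inverts the phases, and `i⁻¹ = -i`.
  have hminus := hpart (-1) (by norm_num) (-Complex.I) fun j => by
    have := (hτ j).inv₀ Complex.I_ne_zero
    rw [Complex.inv_I] at this
    refine this.congr fun k => ?_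
    rw [← Complex.exp_neg]
    ring_nf
  have hdecomp : ∀ k, (transitionMatrix (doubleSubdividedStar l l) (τ k)).mulVec
      (Pi.single (coalescenceLeft l l) 1) = (1 / 2 : ℂ) •
      ((transitionMatrix (doubleSubdividedStar l l) (τ k)).mulVec
        (Pi.single (coalescenceLeft l l) 1 + (1 : ℂ) • Pi.single (coalescenceRight l l) 1) +
      (transitionMatrix (doubleSubdividedStar l l) (τ k)).mulVec
        (Pi.single (coalescenceLeft l l) 1 +
          (-1 : ℂ) • Pi.single (coalescenceRight l l) 1)) := fun k => by
    rw [← Matrix.mulVec_add, ← Matrix.mulVec_smul]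
    congr 1
    module
  simp_rw [hdecomp]
  convert! (hplus.add hminus).const_smul (1 / 2 : ℂ) using 2
  module

/-! ### The case `l = 0` and the conclusion -/

theorem exp_I_mul_four_mul_sub_one (q : ℤ) :
    Complex.exp (Complex.I * (((4 * (q : ℝ) - 1) * (Real.pi / 2) : ℝ) : ℂ)) = -Complex.I := by
  have : Complex.I * (((4 * (q : ℝ) - 1) * (Real.pi / 2) : ℝ) : ℂ) =
      -(Real.pi / 2 * Complex.I) + q * (2 * Real.pi * Complex.I) := by
    push_cast
    ring
  rw [this, Complex.exp_add, Complex.exp_int_mul_two_pi_mul_I, mul_one, Complex.exp_neg,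
    Complex.exp_pi_div_two_mul_I, Complex.inv_I]

-- For `l = 0` the cubic is `(X-1)²(X+1)`, without three distinct roots, so `K₂` is treated
-- directly.
open Classical in
theorem adjMatrix_zero_mulVec {s : ℂ} (hs : s * s = 1) :
    ((doubleSubdividedStar 0 0).adjMatrix ℂ).mulVec
      (Pi.single (coalescenceLeft 0 0) 1 + s • Pi.single (coalescenceRight 0 0) 1) =
      s • (Pi.single (coalescenceLeft 0 0) 1 + s • Pi.single (coalescenceRight 0 0) 1) := by
  have hsymm : ∀ u v, (doubleSubdividedStar 0 0).Adj (Sum.inr u) (Sum.inl v) ↔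
      v = none ∧ u = none := fun u v => by
    rw [SimpleGraph.adj_comm, doubleSubdividedStar_adj_inl_inr]
  funext u
  simp only [Matrix.mulVec, dotProduct, SimpleGraph.adjMatrix_apply, Fintype.sum_sum_type,
    Fintype.sum_option]
  rcases u with (_ | ⟨i, j⟩) | (_ | ⟨i, j⟩)
  · simp [doubleSubdividedStar_adj_inl_inl, doubleSubdividedStar_adj_inl_inr, coalescenceLeft,
      coalescenceRight]
  · exact i.elim0
  · simp [doubleSubdividedStar_adj_inr_inr, hsymm, coalescenceLeft, coalescenceRight, hs]
  · exact i.elim0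

theorem transitionMatrix_zero_mulVec (q : ℤ) :
    (transitionMatrix (doubleSubdividedStar 0 0) ((4 * (q : ℝ) - 1) * (Real.pi / 2))).mulVec
      (Pi.single (coalescenceLeft 0 0) 1) =
      -Complex.I • Pi.single (coalescenceRight 0 0) (1 : ℂ) := by
  classical
  have hexp := exp_I_mul_four_mul_sub_one q
  have hdecomp : (Pi.single (coalescenceLeft 0 0) 1 : DoubleStarVertex 0 0 → ℂ) = (1 / 2 : ℂ) •
      ((Pi.single (coalescenceLeft 0 0) 1 + (1 : ℂ) • Pi.single (coalescenceRight 0 0) 1) +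
      (Pi.single (coalescenceLeft 0 0) 1 + (-1 : ℂ) • Pi.single (coalescenceRight 0 0) 1)) := by
    module
  rw [hdecomp, Matrix.mulVec_smul, Matrix.mulVec_add, transitionMatrix,
    exp_smul_mulVec_of_eigenvector (adjMatrix_zero_mulVec (one_mul 1)),
    exp_smul_mulVec_of_eigenvector (adjMatrix_zero_mulVec (by norm_num)), mul_neg_one,
    Complex.exp_neg, mul_one, hexp, inv_neg, Complex.inv_I]
  module

theorem theorem3p2 (l : ℕ) :
    PrettyGoodStateTransferIn (doubleSubdividedStar l l)
      (coalescenceLeft l l) (coalescenceRight l l)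
      {t : ℝ | ∃ q : ℤ, t = (4 * (q : ℝ) - 1) * (Real.pi / 2)} := by
  refine ⟨by simp [coalescenceLeft, coalescenceRight], ?_⟩
  rcases Nat.eq_zero_or_pos l with rfl | hl
  · refine ⟨fun _ => (4 * ((0 : ℤ) : ℝ) - 1) * (Real.pi / 2), -Complex.I, fun _ => ⟨0, rfl⟩, ?_⟩
    simp only [transitionMatrix_zero_mulVec]
    exact tendsto_const_nhds
  obtain ⟨x, y, z, hxy, hyz, hx, hy, hz⟩ := exists_cubic_roots hl
  have hsum := cubic_roots_sum hxy hyz hx hy hz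
  choose q hqx hqy using fun k : ℕ =>
    exists_time_near_I hl hxy.ne hx hy (Nat.one_div_pos_of_nat (α := ℝ) (n := k))
  set τ : ℕ → ℝ := fun k => (4 * (q k : ℝ) - 1) * (Real.pi / 2) with hτ
  have hlim : ∀ v : ℝ, (∀ k, ‖Complex.exp (Complex.I * τ k * v) - Complex.I‖ < 1 / ((k : ℝ) + 1)) →
      Tendsto (fun k => Complex.exp (Complex.I * τ k * v)) atTop (𝓝 Complex.I) := fun v hv =>
    tendsto_iff_norm_sub_tendsto_zero.2 <| squeeze_zero (fun _ => norm_nonneg _)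
      (fun k => (hv k).le) tendsto_one_div_add_atTop_nhds_zero_nat
  have hx' := hlim x hqx
  have hy' := hlim y hqy
  -- The three phases multiply to `exp(iτ) = -i`, so the third tends to `-i / (i · i) = i`.
  have hz' : Tendsto (fun k => Complex.exp (Complex.I * τ k * z)) atTop (𝓝 Complex.I) := by
    have h := ((hx'.mul hy').inv₀ (by simp)).const_mul (-Complex.I)
    rw [Complex.I_mul_I, inv_neg, inv_one, mul_neg, mul_one, neg_neg] at h
    refine h.congr fun k => ?_
    rw [← exp_I_mul_four_mul_sub_one (q k), ← Complex.exp_add, ← Complex.exp_neg,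
      ← Complex.exp_add]
    have hz'' : (z : ℂ) = 1 - x - y := by
      have : z = 1 - x - y := by linarith
      rw [this]
      push_cast
      ring
    rw [hz'']
    congr 1
    simp only [hτ]
    ring
  have hroot : ∀ v : ℝ, v ^ 3 - v ^ 2 - (l + 1) * v + 1 = 0 →
      ((v : ℂ) - 1) * ((v : ℂ) ^ 2 - 1) = l * v := fun v hv => by
    have : (v : ℂ) ^ 3 - v ^ 2 - (l + 1) * v + 1 = 0 := by exact_mod_cast hv
    linear_combination this
  have hxy0 : (x : ℂ) - y ≠ 0 := by
    rw [sub_ne_zero]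
    exact_mod_cast hxy.ne
  have hyz0 : (y : ℂ) - z ≠ 0 := by
    rw [sub_ne_zero]
    exact_mod_cast hyz.ne
  have hxz0 : (x : ℂ) - z ≠ 0 := by
    rw [sub_ne_zero]
    exact_mod_cast (hxy.trans hyz).ne
  refine ⟨τ, Complex.I, fun k => ⟨q k, rfl⟩, ?_⟩
  -- Lagrange weights `1 / ∏_{k ≠ j} (x_j - x_k)`: their moments of order 0, 1, 2 are 0, 0, 1.
  refine tendsto_transitionMatrix_mulVec (ι := Fin 3)
    (w := ![1 / (((x : ℂ) - y) * (x - z)), -1 / ((x - y) * (y - z)), 1 / ((x - z) * (y - z))])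
    (x := ![(x : ℂ), y, z]) ?_ ?_ ?_ ?_ ?_
  · intro j
    fin_cases j
    exacts [hroot x hx, hroot y hy, hroot z hz]
  · simp only [Fin.sum_univ_three, Matrix.cons_val]
    field_simp
    ring
  · simp only [Fin.sum_univ_three, Matrix.cons_val]
    field_simp
    ring
  · simp only [Fin.sum_univ_three, Matrix.cons_val]
    field_simp
    ring
  · intro j
    fin_cases j
    exacts [hx', hy', hz']
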